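/- Let $f:\mathbb{R}\to\mathbb{R}$ be piecewise smooth: $\mathbb{R}$ is a disjoint union of finitely many intervals (one-point intervals allowed), on each of which $f$ is continuously differentiable and either strictly monotonic or constant. A \emph{flat section} of $f$ is a nondegenerate interval on which $f$ is constant; assume that $f'(z)\neq 0$ for Lebesgue-almost every $z$ outside the flat sections. Let $Z\sim\mathcal{N}(0,1)$ and $Y=f(Z)$, and assume $H(\lfloor Y\rfloor)<\infty$, where $H$ is the Shannon entropy of a discrete random variable. Then the information dimension \[ d(Y)=\lim_{M\to\infty}\frac{H\left(\lfloor MY\rfloor/M\right)}{\log M} \] ($M$ ranging over the positive integers) and the conditional MMSE dimension \[ \mathscr{D}(Z|Y)=\lim_{\mathsf{snr}\to\infty}\mathsf{snr}\cdot\mathbb{E}\left[\left(Z-\mathbb{E}\left[Z\,\middle|\,\sqrt{\mathsf{snr}}\,Z+N,\;Y\right]\right)^2\right],\qquad N\sim\mathcal{N}(0,1)\text{ independent of }Z, \] both exist, and \[ d(Y)=1-\mathscr{D}(Z|Y). \] Moreover $\mathscr{D}(Z|Y)=\mathbb{P}\{f(Z)\in\mathcal{Q}_f\}$, where $\mathcal{Q}_f=\{y: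 f^{-1}(y)\text{ contains a nondegenerate interval}\}$, and this equals the probability that $Z$ lies in a flat section of $f$. -/

import Mathlib

open MeasureTheory ProbabilityTheory Filter Topology
open scoped ENNReal

/-- Shannon entropy (in nats) `∑ₓ -ℙ(W = x) log ℙ(W = x)` of a discrete random variable `W`,
with values in `[0, ∞]`. -/
noncomputable def discreteEntropy {Ω α : Type*} [MeasurableSpace Ω] (P : Measure Ω)
    (W : Ω → α) : ℝ≥0∞ :=
  ∑' x : α, ENNReal.ofReal (Real.negMulLog (P.real (W ⁻¹' {x})))

/-- The quantization `⟨x⟩_M = ⌊M x⌋ / M`. -/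
noncomputable def quantize (M : ℕ) (x : ℝ) : ℝ := (⌊(M : ℝ) * x⌋ : ℝ) / M

/-- The information dimension `lim_{M → ∞} H(⟨X⟩_M) / log M` of the real random variable `X`
exists and equals `d`. -/
def HasInformationDimension {Ω : Type*} [MeasurableSpace Ω] (P : Measure Ω) (X : Ω → ℝ)
    (d : ℝ) : Prop :=
  (∀ᶠ M : ℕ in atTop, discreteEntropy P (fun ω => quantize M (X ω)) ≠ ∞) ∧
  Tendsto (fun M : ℕ => (discreteEntropy P (fun ω => quantize M (X ω))).toReal / Real.log M)
    atTop (𝓝 d)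

/-- The conditional MMSE `mmse(Z, snr | U) = 𝔼[(Z - 𝔼[Z | √snr Z + N, U])²]`, where the noise
`N ∼ 𝒩(0,1)` is independent of `(Z, U)`. Here `N` is the second coordinate on `Ω × ℝ`
under the product measure `P ⊗ 𝒩(0,1)`. -/
noncomputable def condMMSE {Ω β : Type*} [MeasurableSpace Ω] [MeasurableSpace β]
    (P : Measure Ω) (Z : Ω → ℝ) (U : Ω → β) (snr : ℝ) : ℝ :=
  ∫ p : Ω × ℝ,
    (Z p.1 -
      ((P.prod (gaussianReal 0 1))[fun q : Ω × ℝ => Z q.1 |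
        MeasurableSpace.comap (fun q : Ω × ℝ => (√snr * Z q.1 + q.2, U q.1)) inferInstance]) p) ^ 2
    ∂(P.prod (gaussianReal 0 1))

/-- The conditional MMSE dimension `𝒟(Z | U) = lim_{snr → ∞} snr · mmse(Z, snr | U)` exists and
equals `D`. -/
def HasCondMMSEDimension {Ω β : Type*} [MeasurableSpace Ω] [MeasurableSpace β]
    (P : Measure Ω) (Z : Ω → ℝ) (U : Ω → β) (D : ℝ) : Prop :=
  Tendsto (fun snr : ℝ => snr * condMMSE P Z U snr) atTop (𝓝 D)

/-- `ℝ` is a disjoint union of finitely many intervals (of any kind, one-point intervals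
included), on each of which `f` is `C¹` and either strictly monotonic or constant. -/
def IsPiecewiseSmooth (f : ℝ → ℝ) : Prop :=
  ∃ (K : ℕ) (I : Fin K → Set ℝ),
    (∀ k, (I k).OrdConnected) ∧
    (∀ j k, j ≠ k → Disjoint (I j) (I k)) ∧
    (⋃ k, I k) = Set.univ ∧
    ∀ k, ContDiffOn ℝ 1 f (I k) ∧
      (StrictMonoOn f (I k) ∨ StrictAntiOn f (I k) ∨ ∃ c, ∀ x ∈ I k, f x = c)

/-- The values `y` for which `f⁻¹(y)` contains a (nondegenerate) interval. -/
def flatValues (f : ℝ → ℝ) : Set ℝ :=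
  {y | ∃ a b : ℝ, a < b ∧ Set.Ioo a b ⊆ f ⁻¹' {y}}

/-- The union of the flat sections of `f`: the points lying in some nondegenerate interval on
which `f` is constant. -/
def flatSections (f : ℝ → ℝ) : Set ℝ :=
  {z | ∃ a b : ℝ, a < b ∧ z ∈ Set.Icc a b ∧ ∀ w ∈ Set.Icc a b, f w = f z}

/-!
Both dimensions are read off the discrete part of the law of `Y = f(Z)`. The set `Q` of flat
values of `f` is countable. A null set of other values has a null preimage: off the flat sections
`f` splits into finitely many injective pieces with nonzero derivative almost everywhere. So `Y` is
a mixture of a discrete law of mass `ℙ(Y ∈ Q)` and an absolutely continuous one.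

*Information dimension.* The continuous part puts mass `O(1/M)` on all cells of length `1/M` except
a few of small total probability, which forces `H ≥ ℙ(Y ∉ Q) log M - o(log M)`. Conversely, finitely
many atoms of `Y` contribute `O(1)` entropy, and refining unit cells into `M` pieces adds at most
`log M` times the mass of the rest.

*MMSE dimension, upper bound.* Estimate `Z` from `x = Z + N / √snr` by `x` itself when `Y ∈ Q`, and
otherwise by the preimage of `Y` nearest to `x`. Finitely many preimages are candidates, so the
second rule errs by at most `2 |x - Z|` and is exact once the noise is small: only the event
`Y ∈ Q` contributes to the limit, namely its probability.

*MMSE dimension, lower bound.* On an atom `Y = u`, let `w` be the density of `Z`. Given the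
observation, the noises `n` and `-n` compete, with weights `w (x - n / √snr)` and
`w (x + n / √snr)`. Keeping only the minimum of the two makes the noise symmetric, so that its best
estimate is `0` and the error is at least its second moment. Continuity of translations in `L¹`
makes this converge to `ℙ(Y = u) 𝔼[N²] = ℙ(Y = u)`; sum over finitely many atoms.
-/

/-- A weak form of piecewise smoothness: finitely many measurable sets, on each of which `f` is
injective, cover the complement of the flat sections of `f`. -/
def IsPiecewiseInjOffFlat (f : ℝ → ℝ) : Prop :=
  ∃ 𝒮 : Set (Set ℝ), 𝒮.Finite ∧ (∀ s ∈ 𝒮, MeasurableSet s ∧ Set.InjOn f s) ∧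
    (flatSections f)ᶜ ⊆ ⋃₀ 𝒮

section Flat

variable {f : ℝ → ℝ}

theorem measurable_of_continuousOn_of_iUnion_eq_univ {X Y ι : Type*} [TopologicalSpace X]
    [MeasurableSpace X] [OpensMeasurableSpace X] [TopologicalSpace Y] [MeasurableSpace Y]
    [BorelSpace Y] [Countable ι] {g : X → Y} {s : ι → Set X} (hs : ∀ i, MeasurableSet (s i))
    (hg : ∀ i, ContinuousOn g (s i)) (huniv : ⋃ i, s i = Set.univ) : Measurable g := by
  intro B hB
  rw [← Set.univ_inter (g ⁻¹' B), ← huniv, Set.iUnion_inter]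
  refine MeasurableSet.iUnion fun i => ?_
  rw [← Subtype.image_preimage_coe]
  exact (hs i).subtype_image ((hg i).domRestrict.measurable hB)

theorem IsPiecewiseSmooth.measurable (hf : IsPiecewiseSmooth f) : Measurable f := by
  obtain ⟨K, I, hI, -, huniv, hsmooth⟩ := hf
  exact measurable_of_continuousOn_of_iUnion_eq_univ (fun k => (hI k).measurableSet)
    (fun k => (hsmooth k).1.continuousOn) huniv

theorem mem_flatSections_of_const_on {s : Set ℝ} (hs : s.OrdConnected) {c z w : ℝ}
    (hc : ∀ x ∈ s, f x = c) (hz : z ∈ s) (hw : w ∈ s) (hne : w ≠ z) : z ∈ flatSections f := by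
  refine ⟨min z w, max z w, min_lt_max.2 hne.symm, Set.left_mem_uIcc, fun x hx => ?_⟩
  rw [hc x (hs.uIcc_subset hz hw hx), hc z hz]

theorem IsPiecewiseSmooth.isPiecewiseInjOffFlat (hf : IsPiecewiseSmooth f) :
    IsPiecewiseInjOffFlat f := by
  obtain ⟨K, I, hI, -, huniv, hsmooth⟩ := hf
  refine ⟨{s ∈ Set.range I | Set.InjOn f s}, (Set.finite_range I).sep _, ?_, fun z hz => ?_⟩
  · rintro _ ⟨⟨k, rfl⟩, hinj⟩
    exact ⟨(hI k).measurableSet, hinj⟩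
  obtain ⟨k, hk⟩ := Set.mem_iUnion.1 (huniv ▸ Set.mem_univ z)
  refine Set.mem_sUnion.2 ⟨I k, ⟨⟨k, rfl⟩, ?_⟩, hk⟩
  rcases (hsmooth k).2 with hmono | hanti | ⟨c, hc⟩
  · exact hmono.injOn
  · exact hanti.injOn
  · have hsub : ∀ w ∈ I k, w = z := fun w hw => by
      by_contra hne
      exact hz (mem_flatSections_of_const_on (hI k) hc hk hw hne)
    exact fun x hx y hy _ => (hsub x hx).trans (hsub y hy).symm

theorem map_mem_flatValues_of_mem_flatSections {z : ℝ} (hz : z ∈ flatSections f) :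
    f z ∈ flatValues f := by
  obtain ⟨a, b, hab, -, hconst⟩ := hz
  exact ⟨a, b, hab, fun w hw => hconst w (Set.Ioo_subset_Icc_self hw)⟩

theorem countable_flatValues (f : ℝ → ℝ) : (flatValues f).Countable := by
  refine Set.PairwiseDisjoint.countable_of_nonempty_interior (s := fun y => f ⁻¹' {y})
    (fun y _ y' _ hne => (Set.disjoint_singleton.2 hne).preimage f) ?_
  rintro y ⟨a, b, hab, hsub⟩
  exact (Set.nonempty_Ioo.2 hab).mono (interior_maximal hsub isOpen_Ioo)

theorem IsPiecewiseInjOffFlat.ae_mem_flatSections (hf : IsPiecewiseInjOffFlat f) :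
    ∀ᵐ z, f z ∈ flatValues f → z ∈ flatSections f := by
  obtain ⟨𝒮, hfin, hinj, hcover⟩ := hf
  have hnull : volume (⋃ s ∈ 𝒮, s ∩ f ⁻¹' flatValues f) = 0 := by
    refine (hfin.countable.biUnion fun s hs => ?_).measure_zero volume
    refine Set.MapsTo.countable_of_injOn (f := f) (fun z hz => hz.2)
      ((hinj s hs).2.mono Set.inter_subset_left) (countable_flatValues f)
  filter_upwards [measure_eq_zero_iff_ae_notMem.1 hnull] with z hz hflat
  by_contra hsec
  obtain ⟨s, hs, hzs⟩ := hcover hsec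
  exact hz (Set.mem_biUnion hs ⟨hzs, hflat⟩)

theorem addHaar_eq_zero_of_addHaar_image_eq_zero {E : Type*} [NormedAddCommGroup E]
    [NormedSpace ℝ E] [FiniteDimensional ℝ E] [MeasurableSpace E] [BorelSpace E] (μ : Measure E)
    [μ.IsAddHaarMeasure] {g : E → E} {g' : E → E →L[ℝ] E} {s : Set E} (hs : MeasurableSet s)
    (hg' : ∀ x ∈ s, HasFDerivWithinAt g (g' x) s x) (hinj : Set.InjOn g s)
    (hdet : ∀ x ∈ s, (g' x).det ≠ 0) (himage : μ (g '' s) = 0) : μ s = 0 := by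
  have hint := lintegral_abs_det_fderiv_eq_addHaar_image μ hs hg' hinj
  rw [himage, lintegral_eq_zero_iff' (aemeasurable_ofReal_abs_det_fderivWithin μ hs hg'),
    EventuallyEq, ae_restrict_iff' hs] at hint
  rw [measure_eq_zero_iff_ae_notMem]
  filter_upwards [hint] with x hx hxs
  exact hdet x hxs (by simpa using hx hxs)

theorem volume_eq_zero_of_volume_image_eq_zero {g g' : ℝ → ℝ} {s : Set ℝ} (hs : MeasurableSet s)
    (hg' : ∀ x ∈ s, HasDerivWithinAt g (g' x) s x) (hinj : Set.InjOn g s)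
    (hne : ∀ x ∈ s, g' x ≠ 0) (himage : volume (g '' s) = 0) : volume s = 0 :=
  addHaar_eq_zero_of_addHaar_image_eq_zero volume hs
    (fun x hx => (hg' x hx).hasFDerivWithinAt) hinj
    (fun x hx => by simpa only [ContinuousLinearMap.det_toSpanSingleton] using hne x hx) himage

theorem IsPiecewiseInjOffFlat.volume_preimage_diff_flatValues (hf : IsPiecewiseInjOffFlat f)
    (hmeas : Measurable f) (hcrit : ∀ᵐ z, z ∉ flatSections f → deriv f z ≠ 0)
    {B : Set ℝ} (hB : MeasurableSet B) (hB0 : volume B = 0) :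
    volume (f ⁻¹' (B \ flatValues f)) = 0 := by
  obtain ⟨𝒮, hfin, hinj, hcover⟩ := hf
  have hregular : volume (⋃ s ∈ 𝒮, s ∩ f ⁻¹' B ∩ {z | deriv f z ≠ 0}) = 0 := by
    rw [measure_biUnion_null_iff hfin.countable]
    intro s hs
    refine volume_eq_zero_of_volume_image_eq_zero
      (((hinj s hs).1.inter (hmeas hB)).inter
        (measurable_deriv f (measurableSet_singleton (0 : ℝ)).compl))
      (fun z hz => (differentiableAt_of_deriv_ne_zero hz.2).hasDerivAt.hasDerivWithinAt)
      ((hinj s hs).2.mono fun z hz => hz.1.1) (fun z hz => hz.2) (measure_mono_null ?_ hB0)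
    rintro _ ⟨z, hz, rfl⟩
    exact hz.1.2
  rw [measure_eq_zero_iff_ae_notMem]
  filter_upwards [measure_eq_zero_iff_ae_notMem.1 hregular, hcrit] with z hz hzcrit hmem
  have hsec : z ∉ flatSections f := fun h => hmem.2 (map_mem_flatValues_of_mem_flatSections h)
  obtain ⟨s, hs, hzs⟩ := hcover hsec
  exact hz (Set.mem_biUnion hs ⟨⟨hzs, hmem.1⟩, hzcrit hsec⟩)

theorem IsPiecewiseInjOffFlat.restrict_map_absolutelyContinuous (hf : IsPiecewiseInjOffFlat f)
    (hmeas : Measurable f) (hcrit : ∀ᵐ z, z ∉ flatSections f → deriv f z ≠ 0) {ν : Measure ℝ}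
    (hν : ν ≪ volume) : (ν.map f).restrict (flatValues f)ᶜ ≪ volume := by
  refine Measure.AbsolutelyContinuous.mk fun B hB hB0 => ?_
  rw [Measure.restrict_apply hB,
    Measure.map_apply hmeas (hB.inter (countable_flatValues f).measurableSet.compl),
    ← Set.sdiff_eq]
  exact hν (hf.volume_preimage_diff_flatValues hmeas hcrit hB hB0)

end Flat

section Entropy

theorem discreteEntropy_comp_injective {Ω α β : Type*} [MeasurableSpace Ω] (P : Measure Ω)
    (W : Ω → α) {g : α → β} (hg : Function.Injective g) :
    discreteEntropy P (fun ω => g (W ω)) = discreteEntropy P W := by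
  have hpreimage (x : α) : (fun ω => g (W ω)) ⁻¹' {g x} = W ⁻¹' {x} := by
    ext ω
    simp [hg.eq_iff]
  unfold discreteEntropy
  rw [← hg.tsum_eq]
  · simp only [hpreimage]
  · refine Function.support_subset_iff'.2 fun y hy => ?_
    have hempty : (fun ω => g (W ω)) ⁻¹' {y} = ∅ :=
      Set.eq_empty_of_forall_notMem fun ω hω => hy ⟨W ω, hω⟩
    simp [hempty]

theorem discreteEntropy_map {Ω α β : Type*} [MeasurableSpace Ω] [MeasurableSpace α]
    [MeasurableSpace β] [MeasurableSingletonClass β] (P : Measure Ω) {Y : Ω → α}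
    (hY : Measurable Y) {T : α → β} (hT : Measurable T) :
    discreteEntropy (P.map Y) T = discreteEntropy P (fun ω => T (Y ω)) :=
  tsum_congr fun x => by
    rw [map_measureReal_apply hY (hT (measurableSet_singleton x)), ← Set.preimage_comp,
      Function.comp_def]

theorem discreteEntropy_le_add_card {α ι : Type*} [MeasurableSpace α] {μ ν : Measure α}
    {T : α → ι} {J : Finset ι} (h : ∀ j ∉ J, μ.real (T ⁻¹' {j}) = ν.real (T ⁻¹' {j})) :
    discreteEntropy μ T ≤ discreteEntropy ν T + J.card := by
  classical
  have hcard : ∑' j, (if j ∈ J then (1 : ℝ≥0∞) else 0) = J.card := by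
    rw [tsum_eq_sum (s := J) fun j hj => if_neg hj]
    simp
  unfold discreteEntropy
  rw [← hcard, ← ENNReal.tsum_add]
  refine ENNReal.tsum_le_tsum fun j => ?_
  by_cases hj : j ∈ J
  · rw [if_pos hj]
    refine le_add_left (ENNReal.ofReal_le_one.2 ?_)
    linarith [Real.negMulLog_le_one_sub_self (measureReal_nonneg (μ := μ) (s := T ⁻¹' {j})),
      measureReal_nonneg (μ := μ) (s := T ⁻¹' {j})]
  · simp [hj, h j hj]

theorem measureReal_restrict_compl_preimage_singleton {α ι : Type*} [MeasurableSpace α]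
    [DecidableEq ι] (μ : Measure α) (T : α → ι) {F : Finset α} {j : ι} (hj : j ∉ F.image T) :
    (μ.restrict (F : Set α)ᶜ).real (T ⁻¹' {j}) = μ.real (T ⁻¹' {j}) :=
  congrArg ENNReal.toReal <| Measure.restrict_eq_self μ fun _ hx hxF =>
    hj (Finset.mem_image.2 ⟨_, hxF, hx⟩)

theorem sum_negMulLog_le {ι : Type*} [Fintype ι] [Nonempty ι] {a : ι → ℝ} (ha : ∀ i, 0 ≤ a i) :
    ∑ i, Real.negMulLog (a i) ≤
      Real.negMulLog (∑ i, a i) + (∑ i, a i) * Real.log (Fintype.card ι) := by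
  have hcard : (0 : ℝ) < Fintype.card ι := by exact_mod_cast Fintype.card_pos
  have hjensen := Real.concaveOn_negMulLog.le_map_sum (t := Finset.univ)
    (w := fun _ : ι => (Fintype.card ι : ℝ)⁻¹) (p := a) (fun i _ => by positivity)
    (by simp [hcard.ne']) (fun i _ => ha i)
  simp only [smul_eq_mul, ← Finset.mul_sum] at hjensen
  rw [Real.negMulLog_mul, Real.negMulLog, Real.log_inv] at hjensen
  have hscaled := mul_le_mul_of_nonneg_left hjensen hcard.le
  field_simp at hscaled
  linarith

theorem sum_measureReal_preimage_prodMk {α ι κ : Type*} [MeasurableSpace α] [MeasurableSpace ι]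
    [MeasurableSingletonClass ι] [Fintype κ] [MeasurableSpace κ] [MeasurableSingletonClass κ]
    {ν : Measure α} [IsFiniteMeasure ν] {φ : α → ι × κ} (hφ : Measurable φ) (n : ι) :
    ∑ i : κ, ν.real (φ ⁻¹' {(n, i)}) = ν.real ((fun x => (φ x).1) ⁻¹' {n}) := by
  have hunion : (fun x => (φ x).1) ⁻¹' {n} = ⋃ i, φ ⁻¹' {(n, i)} := by
    ext x
    simp [Prod.ext_iff]
  rw [hunion, measureReal_iUnion_fintype (fun i j hij => Disjoint.preimage _ (by simpa using hij))
    (fun i => hφ (measurableSet_singleton _))]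

theorem discreteEntropy_prod_le {α ι κ : Type*} [MeasurableSpace α] [MeasurableSpace ι]
    [MeasurableSingletonClass ι] [Countable ι] [Fintype κ] [Nonempty κ] [MeasurableSpace κ]
    [MeasurableSingletonClass κ] {ν : Measure α} (hν : ν Set.univ ≤ 1) {φ : α → ι × κ}
    (hφ : Measurable φ) :
    discreteEntropy ν φ ≤ discreteEntropy ν (fun x => (φ x).1) +
      ENNReal.ofReal (Real.log (Fintype.card κ)) * ν Set.univ := by
  have : IsFiniteMeasure ν := ⟨hν.trans_lt ENNReal.one_lt_top⟩
  have hle (s : Set α) : ν.real s ≤ 1 :=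
    ENNReal.toReal_le_of_le_ofReal zero_le_one
      (((measure_mono s.subset_univ).trans hν).trans_eq ENNReal.ofReal_one.symm)
  have hlog : 0 ≤ Real.log (Fintype.card κ) := Real.log_natCast_nonneg _
  have hfst : Measurable fun x => (φ x).1 := measurable_fst.comp hφ
  have htotal : ∑' n, ENNReal.ofReal (Real.log (Fintype.card κ)) *
      ν ((fun x => (φ x).1) ⁻¹' {n}) = ENNReal.ofReal (Real.log (Fintype.card κ)) * ν Set.univ := by
    rw [ENNReal.tsum_mul_left, ← Set.preimage_univ (f := fun x => (φ x).1),
      ← tsum_measure_preimage_singleton Set.countable_univ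
        fun n _ => hfst (measurableSet_singleton n),
      tsum_univ fun n => ν ((fun x => (φ x).1) ⁻¹' {n})]
  unfold discreteEntropy
  rw [← htotal, ← ENNReal.tsum_add, ENNReal.tsum_prod']
  refine ENNReal.tsum_le_tsum fun n => ?_
  rw [tsum_fintype, ← ofReal_measureReal, ← ENNReal.ofReal_mul hlog,
    ← ENNReal.ofReal_sum_of_nonneg fun i _ => Real.negMulLog_nonneg measureReal_nonneg (hle _),
    ← ENNReal.ofReal_add (Real.negMulLog_nonneg measureReal_nonneg (hle _)) (by positivity),
    mul_comm (Real.log _), ← sum_measureReal_preimage_prodMk hφ]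
  exact ENNReal.ofReal_le_ofReal (sum_negMulLog_le fun i => measureReal_nonneg)

theorem ofReal_neg_log_mul_measure_le_discreteEntropy {α ι : Type*} [MeasurableSpace α]
    [Countable ι] {ν : Measure α} [IsFiniteMeasure ν] {T : α → ι}
    (hT : ∀ j, MeasurableSet (T ⁻¹' {j})) (c : ℝ) :
    ENNReal.ofReal (-Real.log c) * ν (T ⁻¹' {j | ν.real (T ⁻¹' {j}) ≤ c}) ≤
      discreteEntropy ν T := by
  rw [← tsum_measure_preimage_singleton (Set.to_countable _) fun j _ => hT j,
    ← ENNReal.tsum_mul_left]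
  refine le_trans (ENNReal.tsum_le_tsum fun j => ?_)
    (ENNReal.tsum_comp_le_tsum_of_injective Subtype.val_injective _)
  obtain ⟨j, hj⟩ := j
  rw [← ofReal_measureReal, ← ENNReal.ofReal_mul' measureReal_nonneg]
  refine ENNReal.ofReal_le_ofReal ?_
  rcases (measureReal_nonneg (μ := ν) (s := T ⁻¹' {j})).eq_or_lt' with hzero | hpos
  · simp [hzero]
  · rw [Real.negMulLog, neg_mul, neg_mul, neg_le_neg_iff, mul_comm]
    exact mul_le_mul_of_nonneg_right (Real.log_le_log hpos hj) hpos.le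

theorem measure_preimage_le_of_forall_singleton {α ι : Type*} [MeasurableSpace α] [Countable ι]
    {μ ν : Measure α} {T : α → ι} (hT : ∀ j, MeasurableSet (T ⁻¹' {j})) {B : Set ι}
    (h : ∀ j ∈ B, μ (T ⁻¹' {j}) ≤ ν (T ⁻¹' {j})) : μ (T ⁻¹' B) ≤ ν (T ⁻¹' B) := by
  rw [← tsum_measure_preimage_singleton B.to_countable fun j _ => hT j,
    ← tsum_measure_preimage_singleton B.to_countable fun j _ => hT j]
  exact ENNReal.tsum_le_tsum fun j => h j j.2

theorem exists_pos_measure_lt_of_absolutelyContinuous {α : Type*} [MeasurableSpace α]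
    {μ ν : Measure α} [IsFiniteMeasure μ] [SigmaFinite ν] (h : μ ≪ ν) {ε : ℝ≥0∞} (hε : ε ≠ 0) :
    ∃ δ > 0, ∀ s, ν s < δ → μ s < ε := by
  obtain ⟨δ, hδ, hsmall⟩ := exists_pos_setLIntegral_lt_of_measure_lt
    (Measure.lintegral_rnDeriv_lt_top μ ν).ne hε
  exact ⟨δ, hδ, fun s hs => by simpa [Measure.setLIntegral_rnDeriv h] using hsmall s hs⟩

theorem exists_finset_subset_lt_measureReal {α : Type*} [MeasurableSpace α]
    [MeasurableSingletonClass α] {μ : Measure α} [IsFiniteMeasure μ] {s : Set α}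
    (hs : s.Countable) {a : ℝ} (ha : a < μ.real s) : ∃ t : Finset α, ↑t ⊆ s ∧ a < μ.real t := by
  have hsum : HasSum (fun y : s => μ {(y : α)}) (μ s) := by
    convert ENNReal.summable.hasSum
    exact (tsum_measure_preimage_singleton hs
      fun y _ => measurable_id (measurableSet_singleton y)).symm
  obtain ⟨t, ht⟩ := (((ENNReal.tendsto_toReal (measure_ne_top μ s)).comp hsum).eventually_const_lt
    ha).exists
  refine ⟨t.map (Function.Embedding.subtype _), by simp, ht.trans_eq ?_⟩
  rw [measureReal_def, ← sum_measure_singleton, Finset.sum_map]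
  rfl

/-- The index `⌊M y⌋` of the cell of the grid `ℤ / M` that contains `y`. It carries the same
information as `quantize M y` but takes values in a countable type. -/
noncomputable def gridIndex (M : ℕ) (y : ℝ) : ℤ := ⌊(M : ℝ) * y⌋

theorem measurable_gridIndex (M : ℕ) : Measurable (gridIndex M) :=
  Int.measurable_floor.comp (measurable_const_mul _)

theorem volume_preimage_gridIndex_singleton {M : ℕ} (hM : M ≠ 0) (j : ℤ) :
    volume (gridIndex M ⁻¹' {j}) = (M : ℝ≥0∞)⁻¹ := by
  have hpos : (0 : ℝ) < M := by positivity
  have hcell : gridIndex M ⁻¹' {j} = Set.Ico ((j : ℝ) / M) (((j : ℝ) + 1) / M) := by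
    ext y
    simp only [gridIndex, Set.mem_preimage, Set.mem_singleton_iff, Int.floor_eq_iff, Set.mem_Ico]
    rw [div_le_iff₀ hpos, lt_div_iff₀ hpos, mul_comm]
  rw [hcell, Real.volume_Ico, ← sub_div, add_sub_cancel_left, one_div,
    ENNReal.ofReal_inv_of_pos hpos, ENNReal.ofReal_natCast]

theorem discreteEntropy_quantize {Ω : Type*} [MeasurableSpace Ω] (P : Measure Ω) (X : Ω → ℝ)
    {M : ℕ} (hM : M ≠ 0) :
    discreteEntropy P (fun ω => quantize M (X ω)) =
      discreteEntropy P (fun ω => gridIndex M (X ω)) :=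
  discreteEntropy_comp_injective P (fun ω => gridIndex M (X ω)) (g := fun j : ℤ => (j : ℝ) / M)
    fun a b hab => by simpa [div_left_inj', hM] using hab

theorem discreteEntropy_gridIndex_le {ν : Measure ℝ} (hν : ν Set.univ ≤ 1) {M : ℕ} (hM : M ≠ 0) :
    discreteEntropy ν (gridIndex M) ≤
      discreteEntropy ν (fun y => ⌊y⌋) + ENNReal.ofReal (Real.log M) * ν Set.univ := by
  have : NeZero M := ⟨hM⟩
  have h := discreteEntropy_prod_le hν
    ((measurable_of_countable (Int.divModEquiv M)).comp (measurable_gridIndex M))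
  rw [Function.comp_def, discreteEntropy_comp_injective ν (gridIndex M)
    (Int.divModEquiv M).injective] at h
  simpa [gridIndex, Int.natCast_mul_floor_div_cancel hM] using h

theorem discreteEntropy_gridIndex_le_add_card {ν : Measure ℝ} [IsProbabilityMeasure ν]
    (F : Finset ℝ) {M : ℕ} (hM : M ≠ 0) :
    discreteEntropy ν (gridIndex M) ≤ discreteEntropy ν (fun y => ⌊y⌋) + 2 * F.card +
      ENNReal.ofReal (Real.log M) * ν (F : Set ℝ)ᶜ := by
  have hcard (T : ℝ → ℤ) : ((F.image T).card : ℝ≥0∞) ≤ F.card := by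
    exact_mod_cast Finset.card_image_le
  have hrestrict : ν.restrict (F : Set ℝ)ᶜ Set.univ ≤ 1 := by
    simpa using prob_le_one
  calc discreteEntropy ν (gridIndex M)
    _ ≤ discreteEntropy (ν.restrict (F : Set ℝ)ᶜ) (gridIndex M) + F.card :=
      (discreteEntropy_le_add_card fun j hj =>
        (measureReal_restrict_compl_preimage_singleton ν _ hj).symm).trans
        (add_le_add_right (hcard _) _)
    _ ≤ discreteEntropy (ν.restrict (F : Set ℝ)ᶜ) (fun y => ⌊y⌋) +
        ENNReal.ofReal (Real.log M) * ν (F : Set ℝ)ᶜ + F.card := by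
      gcongr
      simpa using discreteEntropy_gridIndex_le hrestrict hM
    _ ≤ discreteEntropy ν (fun y => ⌊y⌋) + F.card +
        ENNReal.ofReal (Real.log M) * ν (F : Set ℝ)ᶜ + F.card := by
      gcongr
      exact (discreteEntropy_le_add_card fun j hj =>
        measureReal_restrict_compl_preimage_singleton ν _ hj).trans (add_le_add_right (hcard _) _)
    _ = _ := by ring

theorem volume_preimage_gridIndex_le_inv {ν : Measure ℝ} [IsProbabilityMeasure ν] {M : ℕ}
    (hM : M ≠ 0) (C : ℝ) :
    volume (gridIndex M ⁻¹' {j | C / M < ν.real (gridIndex M ⁻¹' {j})}) ≤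
      (ENNReal.ofReal C)⁻¹ := by
  have hcell : ∀ j ∈ {j | C / M < ν.real (gridIndex M ⁻¹' {j})},
      (ENNReal.ofReal C • volume) (gridIndex M ⁻¹' {j}) ≤ ν (gridIndex M ⁻¹' {j}) := by
    intro j hj
    rw [Measure.smul_apply, volume_preimage_gridIndex_singleton hM, smul_eq_mul, ← div_eq_mul_inv,
      ← ENNReal.ofReal_natCast, ← ENNReal.ofReal_div_of_pos (by positivity), ← ofReal_measureReal]
    exact ENNReal.ofReal_le_ofReal (Set.mem_ofPred.1 hj).le
  rw [ENNReal.le_inv_iff_mul_le, mul_comm]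
  simpa using (measure_preimage_le_of_forall_singleton
    (fun j => measurable_gridIndex M (measurableSet_singleton j)) hcell).trans prob_le_one

theorem exists_pos_log_mul_le_discreteEntropy {ν : Measure ℝ} [IsProbabilityMeasure ν] {S : Set ℝ}
    (hac : ν.restrict S ≪ volume) {a : ℝ≥0∞} (ha : a < ν S) :
    ∃ C : ℝ, 0 < C ∧ ∀ M : ℕ, M ≠ 0 →
      ENNReal.ofReal (Real.log (M / C)) * a ≤ discreteEntropy ν (gridIndex M) := by
  obtain ⟨δ, hδ, hsmall⟩ :=
    exists_pos_measure_lt_of_absolutelyContinuous hac (tsub_pos_of_lt ha).ne'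
  obtain ⟨C, hC, hCδ⟩ : ∃ C : ℝ, 0 < C ∧ (ENNReal.ofReal C)⁻¹ < δ := by
    obtain ⟨n, hn⟩ := ENNReal.exists_inv_nat_lt hδ.ne'
    refine ⟨n, Nat.cast_pos.2 (Nat.pos_of_ne_zero ?_), by rwa [ENNReal.ofReal_natCast]⟩
    rintro rfl
    simp at hn
  refine ⟨C, hC, fun M hM => ?_⟩
  set light : Set ℝ := gridIndex M ⁻¹' {j | ν.real (gridIndex M ⁻¹' {j}) ≤ C / M}
  have hlight : MeasurableSet light := measurable_gridIndex M (Set.to_countable _).measurableSet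
  have hheavy_volume : volume lightᶜ < δ := by
    refine lt_of_le_of_lt ?_ hCδ
    simpa only [light, ← Set.preimage_compl, Set.compl_ofPred, not_le] using
      volume_preimage_gridIndex_le_inv (ν := ν) hM C
  have hheavy : ν (S \ light) ≤ ν S - a := by
    have h := (hsmall _ hheavy_volume).le
    rwa [Measure.restrict_apply hlight.compl, Set.inter_comm, ← Set.sdiff_eq] at h
  have ha_light : a ≤ ν light := by
    refine ENNReal.le_of_add_le_add_right (a := ν S - a) (by finiteness) ?_
    calc a + (ν S - a)
      _ = ν (S ∩ light) + ν (S \ light) := by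
        rw [add_tsub_cancel_of_le ha.le, measure_inter_add_sdiff S hlight]
      _ ≤ ν light + (ν S - a) := add_le_add (measure_mono Set.inter_subset_right) hheavy
  have hbound := ofReal_neg_log_mul_measure_le_discreteEntropy (ν := ν)
    (fun j => measurable_gridIndex M (measurableSet_singleton j)) (C / M)
  rw [← Real.log_inv, inv_div] at hbound
  exact (mul_le_mul_right ha_light _).trans hbound

theorem tendsto_log_natCast_atTop : Tendsto (fun M : ℕ => Real.log M) atTop atTop :=
  Real.tendsto_log_atTop.comp tendsto_natCast_atTop_atTop

theorem eventually_lt_discreteEntropy_div_log {ν : Measure ℝ} [IsProbabilityMeasure ν] {S : Set ℝ}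
    (hac : ν.restrict S ≪ volume) (hH : ∀ M ≠ 0, discreteEntropy ν (gridIndex M) ≠ ∞) {a : ℝ}
    (ha : a < ν.real S) :
    ∀ᶠ M : ℕ in atTop, a < (discreteEntropy ν (gridIndex M)).toReal / Real.log M := by
  rcases lt_or_ge a 0 with ha0 | ha0
  · exact Eventually.of_forall fun M =>
      ha0.trans_le (div_nonneg ENNReal.toReal_nonneg (Real.log_natCast_nonneg M))
  obtain ⟨a', haa', ha'⟩ := exists_between ha
  obtain ⟨C, hC, hbound⟩ := exists_pos_log_mul_le_discreteEntropy hac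
    ((ENNReal.ofReal_lt_iff_lt_toReal (ha0.trans haa'.le) (measure_ne_top ν S)).2 ha')
  have hlim : Tendsto (fun M : ℕ => (1 - Real.log C / Real.log M) * a') atTop (𝓝 ((1 - 0) * a')) :=
    (tendsto_const_nhds.sub (tendsto_log_natCast_atTop.const_div_atTop _)).mul_const a'
  filter_upwards [hlim.eventually_const_lt (u := a) (by simpa using haa'), eventually_gt_atTop 1]
    with M hlt hM
  have hlogM : 0 < Real.log M := Real.log_pos (by exact_mod_cast hM)
  have hentropy : Real.log (M / C) * a' ≤ (discreteEntropy ν (gridIndex M)).toReal := by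
    have h := hbound M (by positivity)
    rw [← ENNReal.ofReal_mul' (ha0.trans haa'.le)] at h
    exact (ENNReal.ofReal_le_iff_le_toReal (hH M (by positivity))).1 h
  rw [lt_div_iff₀ hlogM]
  refine lt_of_lt_of_le (mul_lt_mul_of_pos_right hlt hlogM) (hentropy.trans_eq' ?_)
  rw [Real.log_div (by positivity) hC.ne']
  field_simp

theorem eventually_discreteEntropy_div_log_lt {ν : Measure ℝ} [IsProbabilityMeasure ν]
    {Q : Set ℝ} (hQ : Q.Countable) (hH : discreteEntropy ν (fun y => ⌊y⌋) ≠ ∞) {b : ℝ}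
    (hb : ν.real Qᶜ < b) :
    ∀ᶠ M : ℕ in atTop, (discreteEntropy ν (gridIndex M)).toReal / Real.log M < b := by
  obtain ⟨F, hF⟩ : ∃ F : Finset ℝ, ν.real (F : Set ℝ)ᶜ < b := by
    rw [probReal_compl_eq_one_sub hQ.measurableSet] at hb
    obtain ⟨F, -, hF⟩ := exists_finset_subset_lt_measureReal (μ := ν) hQ (sub_lt_comm.1 hb)
    exact ⟨F, by rwa [probReal_compl_eq_one_sub F.measurableSet, sub_lt_comm]⟩
  set A : ℝ≥0∞ := discreteEntropy ν (fun y => ⌊y⌋) + 2 * F.card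
  have hA : A ≠ ∞ := by finiteness
  have hlim : Tendsto (fun M : ℕ => A.toReal / Real.log M + ν.real (F : Set ℝ)ᶜ) atTop
      (𝓝 (0 + ν.real (F : Set ℝ)ᶜ)) :=
    (tendsto_log_natCast_atTop.const_div_atTop _).add_const _
  filter_upwards [hlim.eventually_lt_const (u := b) (by simpa using hF), eventually_gt_atTop 1]
    with M hlt hM
  have hlogM : 0 < Real.log M := Real.log_pos (by exact_mod_cast hM)
  have hentropy := ENNReal.toReal_mono (by finiteness)
    (discreteEntropy_gridIndex_le_add_card (ν := ν) F (M := M) (by positivity))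
  rw [ENNReal.toReal_add hA (by finiteness), ENNReal.toReal_mul,
    ENNReal.toReal_ofReal hlogM.le] at hentropy
  refine lt_of_le_of_lt ?_ hlt
  rw [div_le_iff₀ hlogM, add_mul, div_mul_cancel₀ _ hlogM.ne', mul_comm (ν.real _)]
  exact hentropy

/-- This is Rényi's mixture formula for the information dimension. -/
theorem hasInformationDimension_of_restrict_absolutelyContinuous {Ω : Type*} [MeasurableSpace Ω]
    {P : Measure Ω} [IsProbabilityMeasure P] {X : Ω → ℝ} (hX : Measurable X) {Q : Set ℝ}
    (hQ : Q.Countable) (hac : (P.map X).restrict Qᶜ ≪ volume)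
    (hH : discreteEntropy P (fun ω => ⌊X ω⌋) ≠ ∞) :
    HasInformationDimension P X (1 - P.real (X ⁻¹' Q)) := by
  have : IsProbabilityMeasure (P.map X) := Measure.isProbabilityMeasure_map hX.aemeasurable
  rw [← discreteEntropy_map P hX Int.measurable_floor] at hH
  have hquantize {M : ℕ} (hM : M ≠ 0) : discreteEntropy P (fun ω => quantize M (X ω)) =
      discreteEntropy (P.map X) (gridIndex M) := by
    rw [discreteEntropy_quantize P X hM, discreteEntropy_map P hX (measurable_gridIndex M)]
  have hfinite : ∀ M ≠ 0, discreteEntropy (P.map X) (gridIndex M) ≠ ∞ := fun M hM =>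
    ne_top_of_le_ne_top (by finiteness) (discreteEntropy_gridIndex_le_add_card ∅ hM)
  have hmass : (P.map X).real Qᶜ = 1 - P.real (X ⁻¹' Q) := by
    rw [probReal_compl_eq_one_sub hQ.measurableSet, map_measureReal_apply hX hQ.measurableSet]
  refine ⟨?_, ?_⟩
  · filter_upwards [eventually_ne_atTop 0] with M hM
    rw [hquantize hM]
    exact hfinite M hM
  · rw [← hmass]
    refine Tendsto.congr' ?_ (tendsto_order.2
      ⟨fun a ha => eventually_lt_discreteEntropy_div_log hac hfinite ha,
        fun b hb => eventually_discreteEntropy_div_log_lt hQ hH hb⟩)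
    filter_upwards [eventually_ne_atTop 0] with M hM
    rw [hquantize hM]

end Entropy

section GaussianChannel

theorem lintegral_sq_gaussianReal : ∫⁻ n, ENNReal.ofReal (n ^ 2) ∂(gaussianReal 0 1) = 1 := by
  have hvar := variance_eq_sub (memLp_id_gaussianReal (μ := 0) (v := 1) 2)
  rw [variance_id_gaussianReal] at hvar
  have hint : ∫ n, n ^ 2 ∂(gaussianReal 0 1) = 1 := by simpa using hvar.symm
  have hsq : Integrable (fun n : ℝ => n ^ 2) (gaussianReal 0 1) :=
    (memLp_id_gaussianReal 2).integrable_sq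
  rw [← ofReal_integral_eq_lintegral_ofReal hsq (Eventually.of_forall fun n => sq_nonneg n), hint,
    ENNReal.ofReal_one]

instance isNegInvariant_gaussianReal (v : NNReal) : (gaussianReal 0 v).IsNegInvariant :=
  ⟨(gaussianReal_map_neg (μ := 0) (v := v)).trans (by rw [neg_zero])⟩

theorem integral_sub_condExp_sq_le {Ω : Type*} {m m₀ : MeasurableSpace Ω} {P : Measure Ω}
    [IsFiniteMeasure P] (hm : m ≤ m₀) {X g : Ω → ℝ} (hX : MemLp X 2 P)
    (hg : StronglyMeasurable[m] g) (hXg : MemLp (X - g) 2 P) :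
    ∫ ω, (X ω - (P[X | m]) ω) ^ 2 ∂P ≤ ∫ ω, (X ω - g ω) ^ 2 ∂P := by
  have hg_memLp : MemLp g 2 P := by simpa using hX.sub hXg
  have hg_integrable := hg_memLp.integrable one_le_two
  have hsub : (X - g) - P[X - g | m] =ᵐ[P] X - P[X | m] := by
    filter_upwards [condExp_sub (hX.integrable one_le_two) hg_integrable m] with ω hω
    simp only [Pi.sub_apply] at hω ⊢
    rw [hω, condExp_of_stronglyMeasurable hm hg hg_integrable]
    ring
  calc ∫ ω, (X ω - (P[X | m]) ω) ^ 2 ∂P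
    _ = ∫ ω, (((X - g) - P[X - g | m]) ^ 2) ω ∂P := integral_congr_ae (hsub.symm.pow_const 2)
    _ = ∫ ω, (condVar m (X - g) P) ω ∂P := (integral_condExp hm).symm
    _ ≤ ∫ ω, (P[(X - g) ^ 2 | m]) ω ∂P :=
      integral_mono_ae integrable_condVar integrable_condExp (condVar_ae_le_condExp_sq hm hXg)
    _ = ∫ ω, (X ω - g ω) ^ 2 ∂P := integral_condExp hm

variable {Ω β : Type*} [MeasurableSpace Ω] [MeasurableSpace β] {P : Measure Ω}
  {Z : Ω → ℝ} {U : Ω → β}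

/-- The mean square error of the estimator `g` of `Z` from `√snr Z + N` and `U`. -/
noncomputable def meanSqError (P : Measure Ω) (Z : Ω → ℝ) (U : Ω → β) (snr : ℝ)
    (g : ℝ × β → ℝ) : ℝ≥0∞ :=
  ∫⁻ q : Ω × ℝ, ENNReal.ofReal ((Z q.1 - g (√snr * Z q.1 + q.2, U q.1)) ^ 2)
    ∂(P.prod (gaussianReal 0 1))

theorem ofReal_condMMSE_le_meanSqError [IsProbabilityMeasure P] (hZ : Measurable Z)
    (hU : Measurable U) (hZ2 : MemLp Z 2 P) (snr : ℝ) {g : ℝ × β → ℝ} (hg : Measurable g) :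
    ENNReal.ofReal (condMMSE P Z U snr) ≤ meanSqError P Z U snr g := by
  by_cases hfinite : meanSqError P Z U snr g = ∞
  · exact hfinite ▸ le_top
  have herror : Measurable fun q : Ω × ℝ => Z q.1 - g (√snr * Z q.1 + q.2, U q.1) := by fun_prop
  have hint : Integrable (fun q : Ω × ℝ => (Z q.1 - g (√snr * Z q.1 + q.2, U q.1)) ^ 2)
      (P.prod (gaussianReal 0 1)) :=
    (lintegral_ofReal_ne_top_iff_integrable (herror.pow_const 2).aestronglyMeasurable
      (Eventually.of_forall fun q => sq_nonneg _)).1 hfinite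
  rw [meanSqError, ← ofReal_integral_eq_lintegral_ofReal hint
    (Eventually.of_forall fun q => sq_nonneg _)]
  have hobs : Measurable fun q : Ω × ℝ => (√snr * Z q.1 + q.2, U q.1) := by fun_prop
  exact ENNReal.ofReal_le_ofReal <| integral_sub_condExp_sq_le hobs.comap_le (hZ2.comp_fst _)
    (hg.comp (comap_measurable _)).stronglyMeasurable
    ((memLp_two_iff_integrable_sq herror.aestronglyMeasurable).2 hint)

theorem exists_meanSqError_eq_ofReal_condMMSE (hZ2 : MemLp Z 2 P) (snr : ℝ) :
    ∃ g : ℝ × β → ℝ, Measurable g ∧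
      meanSqError P Z U snr g = ENNReal.ofReal (condMMSE P Z U snr) := by
  set m : MeasurableSpace (Ω × ℝ) :=
    MeasurableSpace.comap (fun q : Ω × ℝ => (√snr * Z q.1 + q.2, U q.1)) inferInstance
  have hZ_memLp : MemLp (fun q : Ω × ℝ => Z q.1) 2 (P.prod (gaussianReal 0 1)) := hZ2.comp_fst _
  obtain ⟨g, hg, hcondExp⟩ := (stronglyMeasurable_condExp (m := m) (f := fun q : Ω × ℝ => Z q.1)
    (μ := P.prod (gaussianReal 0 1))).measurable.exists_eq_measurable_comp
  have hint := (hZ_memLp.sub (hZ_memLp.condExp one_le_two (m := m))).integrable_sq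
  rw [hcondExp] at hint
  refine ⟨g, hg, ?_⟩
  rw [condMMSE, hcondExp]
  exact (ofReal_integral_eq_lintegral_ofReal hint
    (Eventually.of_forall fun q => sq_nonneg _)).symm

theorem ofReal_mul_meanSqError_div_sqrt (hZ : Measurable Z) (hU : Measurable U)
    {g : ℝ × β → ℝ} (hg : Measurable g) {s : ℝ} (hs : 0 < s) :
    ENNReal.ofReal s * meanSqError P Z U s (fun y => g (y.1 / √s, y.2)) =
      ∫⁻ q : Ω × ℝ, ENNReal.ofReal (s * (Z q.1 - g (Z q.1 + q.2 / √s, U q.1)) ^ 2)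
        ∂(P.prod (gaussianReal 0 1)) := by
  rw [meanSqError, ← lintegral_const_mul _ (by fun_prop)]
  refine lintegral_congr fun q => ?_
  rw [← ENNReal.ofReal_mul hs.le, add_div, mul_div_cancel_left₀ _ (Real.sqrt_pos.2 hs).ne']

theorem lintegral_mul_sq_prod_gaussianReal [SFinite P] {w : Ω → ℝ≥0∞} (hw : Measurable w) :
    ∫⁻ q : Ω × ℝ, w q.1 * ENNReal.ofReal (q.2 ^ 2) ∂(P.prod (gaussianReal 0 1)) =
      ∫⁻ ω, w ω ∂P := by
  rw [lintegral_prod_mul (g := fun n => ENNReal.ofReal (n ^ 2)) (by fun_prop) (by fun_prop),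
    lintegral_sq_gaussianReal, mul_one]

theorem tendsto_ofReal_mul_meanSqError [IsFiniteMeasure P] (hZ : Measurable Z) (hU : Measurable U)
    {g : ℝ × β → ℝ} (hg : Measurable g) {c : Ω → ℝ} (hc : Measurable c) {C : ℝ}
    (hbound : ∀ᵐ ω ∂P, ∀ x, |Z ω - g (x, U ω)| ≤ C * |x - Z ω|)
    (hlocal : ∀ᵐ ω ∂P, ∀ᶠ x in 𝓝 (Z ω), (Z ω - g (x, U ω)) ^ 2 = c ω * (x - Z ω) ^ 2) :
    Tendsto (fun s : ℝ => ENNReal.ofReal s * meanSqError P Z U s fun y => g (y.1 / √s, y.2)) atTop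
      (𝓝 (∫⁻ ω, ENNReal.ofReal (c ω) ∂P)) := by
  have hrescale {s : ℝ} (hs : 0 < s) (n : ℝ) : s * (n / √s) ^ 2 = n ^ 2 := by
    rw [div_pow, Real.sq_sqrt hs.le, mul_div_cancel₀ _ hs.ne']
  rw [← lintegral_mul_sq_prod_gaussianReal (w := fun ω => ENNReal.ofReal (c ω)) (by fun_prop)]
  refine (tendsto_lintegral_filter_of_dominated_convergence
    (fun q => ENNReal.ofReal (C ^ 2) * ENNReal.ofReal (q.2 ^ 2))
    (Eventually.of_forall fun s => by fun_prop) ?_ ?_ ?_).congr' <|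
    (eventually_gt_atTop 0).mono fun s hs => (ofReal_mul_meanSqError_div_sqrt hZ hU hg hs).symm
  · filter_upwards [eventually_gt_atTop 0] with s hs
    filter_upwards [Measure.quasiMeasurePreserving_fst.ae hbound] with q hq
    have herror := hq (Z q.1 + q.2 / √s)
    rw [add_sub_cancel_left] at herror
    rw [← ENNReal.ofReal_mul (sq_nonneg C)]
    refine ENNReal.ofReal_le_ofReal ?_
    calc s * (Z q.1 - g (Z q.1 + q.2 / √s, U q.1)) ^ 2
      _ ≤ s * (C * |q.2 / √s|) ^ 2 := by rw [← sq_abs (Z q.1 - _)]; gcongr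
      _ = C ^ 2 * q.2 ^ 2 := by rw [mul_pow, sq_abs, mul_left_comm, hrescale hs]
  · rw [lintegral_mul_sq_prod_gaussianReal measurable_const, lintegral_const]
    exact ENNReal.mul_ne_top ENNReal.ofReal_ne_top (measure_ne_top P _)
  · filter_upwards [Measure.quasiMeasurePreserving_fst.ae hlocal] with q hq
    have hx : Tendsto (fun s : ℝ => Z q.1 + q.2 / √s) atTop (𝓝 (Z q.1)) := by
      simpa using (Real.tendsto_sqrt_atTop.const_div_atTop q.2).const_add (Z q.1)
    refine tendsto_const_nhds.congr' ?_
    filter_upwards [eventually_gt_atTop 0, hx.eventually hq] with s hs hlocal_s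
    rw [hlocal_s, add_sub_cancel_left, mul_left_comm, hrescale hs,
      ENNReal.ofReal_mul' (sq_nonneg _)]

theorem eventually_mul_condMMSE_lt [IsProbabilityMeasure P] (hZ : Measurable Z)
    (hU : Measurable U) (hZ2 : MemLp Z 2 P) {Q : Set β} (hQ : MeasurableSet Q)
    {g : ℝ × β → ℝ} (hg : Measurable g) {C : ℝ}
    (hbound : ∀ᵐ ω ∂P, U ω ∉ Q → ∀ x, |Z ω - g (x, U ω)| ≤ C * |x - Z ω|)
    (hlocal : ∀ᵐ ω ∂P, U ω ∉ Q → ∀ᶠ x in 𝓝 (Z ω), g (x, U ω) = Z ω)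
    {b : ℝ} (hb : P.real (U ⁻¹' Q) < b) :
    ∀ᶠ s : ℝ in atTop, s * condMMSE P Z U s < b := by
  classical
  let gQ : ℝ × β → ℝ := fun y => if y.2 ∈ Q then y.1 else g y
  have hgQ : Measurable gQ := Measurable.ite (measurable_snd hQ) measurable_fst hg
  have hlim := tendsto_ofReal_mul_meanSqError (P := P) (c := (U ⁻¹' Q).indicator 1)
    (C := max C 1) hZ hU hgQ (measurable_one.indicator (hU hQ)) ?_ ?_
  · have hvalue : ∫⁻ ω, ENNReal.ofReal ((U ⁻¹' Q).indicator 1 ω) ∂P = P (U ⁻¹' Q) := by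
      rw [← lintegral_indicator_one (hU hQ)]
      exact lintegral_congr fun ω => by by_cases hω : U ω ∈ Q <;> simp [hω]
    have hb' : P (U ⁻¹' Q) < ENNReal.ofReal b :=
      (ENNReal.lt_ofReal_iff_toReal_lt (measure_ne_top P _)).2 hb
    rw [hvalue] at hlim
    filter_upwards [hlim.eventually_lt_const hb', eventually_ge_atTop 0] with s hlt hs
    have hmmse := (mul_le_mul_right
      (ofReal_condMMSE_le_meanSqError hZ hU hZ2 s (hgQ.comp (by fun_prop))) _).trans_lt hlt
    rw [← ENNReal.ofReal_mul hs] at hmmse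
    exact lt_of_not_ge fun hle => (ENNReal.ofReal_le_ofReal hle).not_gt hmmse
  · filter_upwards [hbound] with ω hω x
    by_cases hmem : U ω ∈ Q
    · simpa only [gQ, if_pos hmem, one_mul, abs_sub_comm] using
        mul_le_mul_of_nonneg_right (le_max_right C 1) (abs_nonneg (x - Z ω))
    · simpa only [gQ, if_neg hmem] using
        (hω hmem x).trans (mul_le_mul_of_nonneg_right (le_max_left C 1) (abs_nonneg _))
  · filter_upwards [hlocal] with ω hω
    by_cases hmem : U ω ∈ Q
    · exact Eventually.of_forall fun x => by simp [gQ, hmem, sub_sq_comm]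
    · filter_upwards [hω hmem] with x hx
      simp [gQ, hmem, hx]

end GaussianChannel

section Translation

theorem tendsto_eLpNorm_comp_add_right_sub {G E : Type*} [AddGroup G] [TopologicalSpace G]
    [IsTopologicalAddGroup G] [MeasurableSpace G] [BorelSpace G] {μ : Measure G}
    [μ.IsAddRightInvariant] [IsLocallyFiniteMeasure μ] [μ.InnerRegularCompactLTTop]
    [NormedAddCommGroup E] {p : ℝ≥0∞} [Fact (1 ≤ p)] (hp : p ≠ ∞) {f : G → E} (hf : MemLp f p μ) :
    Tendsto (fun h : G => eLpNorm (fun x => f (x + h) - f x) p μ) (𝓝 0) (𝓝 0) := by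
  let translate : C(G, C(G, G)) := ContinuousMap.curry ⟨fun a => a.2 + a.1, by fun_prop⟩
  have hpreserving (h : G) : MeasurePreserving (translate h) μ μ := measurePreserving_add_right μ h
  have hlim := (tendsto_const_nhds (x := hf.toLp f)).compMeasurePreservingLp
    (translate.continuous.tendsto 0) hpreserving (hpreserving 0) hp
  have hzero : Lp.compMeasurePreserving (translate 0) (hpreserving 0) (hf.toLp f) = hf.toLp f := by
    rw [Lp.toLp_compMeasurePreserving]
    exact MemLp.toLp_congr _ _ (Eventually.of_forall fun x => by simp [translate])
  simp only [hzero, Lp.toLp_compMeasurePreserving] at hlim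
  exact (Lp.tendsto_Lp_iff_tendsto_eLpNorm'' _ (fun h => hf.comp_measurePreserving (hpreserving h))
    f hf).1 hlim

theorem le_add_enorm_toReal_sub_toReal {a : ℝ≥0∞} (ha : a ≠ ∞) (b : ℝ≥0∞) :
    a ≤ b + ‖b.toReal - a.toReal‖ₑ := by
  by_cases hb : b = ∞
  · simp [hb]
  · calc a = ‖b.toReal - (b.toReal - a.toReal)‖ₑ := by simp [ha]
      _ ≤ ‖b.toReal‖ₑ + ‖b.toReal - a.toReal‖ₑ := enorm_sub_le
      _ = b + ‖b.toReal - a.toReal‖ₑ := by simp [hb]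

theorem tendsto_lintegral_min_translate {G : Type*} [AddGroup G] [TopologicalSpace G]
    [IsTopologicalAddGroup G] [MeasurableSpace G] [BorelSpace G] {μ : Measure G}
    [μ.IsAddRightInvariant] [IsLocallyFiniteMeasure μ] [μ.InnerRegularCompactLTTop]
    {w : G → ℝ≥0∞} (hw : Measurable w) (hfinite : ∫⁻ x, w x ∂μ ≠ ∞) :
    Tendsto (fun h => ∫⁻ x, min (w (x - h)) (w (x + h)) ∂μ) (𝓝 0) (𝓝 (∫⁻ x, w x ∂μ)) := by
  have hw_translate (h : G) : Measurable fun x => w (x + h) := hw.comp (measurable_add_const h)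
  let Δ (h : G) : ℝ≥0∞ := eLpNorm (fun x => (w (x + h)).toReal - (w x).toReal) 1 μ
  have hw_memLp : MemLp (fun x => (w x).toReal) 1 μ :=
    memLp_one_iff_integrable.2 (integrable_toReal_of_lintegral_ne_top hw.aemeasurable hfinite)
  have hΔ : Tendsto Δ (𝓝 0) (𝓝 0) :=
    (tendsto_eLpNorm_comp_add_right_sub ENNReal.one_ne_top hw_memLp :)
  have hΔ_neg : Tendsto (fun h => Δ (-h)) (𝓝 0) (𝓝 0) :=
    hΔ.comp (by simpa using tendsto_neg (0 : G))
  have hupper (h : G) : ∫⁻ x, min (w (x - h)) (w (x + h)) ∂μ ≤ ∫⁻ x, w x ∂μ :=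
    (lintegral_mono fun x => min_le_right _ _).trans_eq (lintegral_add_right_eq_self w h)
  have hlower (h : G) :
      ∫⁻ x, w x ∂μ ≤ ∫⁻ x, min (w (x - h)) (w (x + h)) ∂μ + (Δ (-h) + Δ h) := by
    have hdiff (h : G) : Measurable fun x => ‖(w (x + h)).toReal - (w x).toReal‖ₑ :=
      ((hw_translate h).ennreal_toReal.sub hw.ennreal_toReal).enorm
    simp only [Δ, eLpNorm_one_eq_lintegral_enorm, sub_eq_add_neg (_ : G) h]
    rw [← lintegral_add_left (hdiff _),
      ← lintegral_add_left ((hw_translate _).min (hw_translate _))]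
    refine lintegral_mono_ae ?_
    filter_upwards [ae_lt_top hw hfinite] with x hx
    rw [min_add]
    exact le_min
      ((le_add_enorm_toReal_sub_toReal hx.ne _).trans (add_le_add_right le_self_add _))
      ((le_add_enorm_toReal_sub_toReal hx.ne _).trans (add_le_add_right le_add_self _))
  refine tendsto_of_tendsto_of_tendsto_of_le_of_le (g := fun h => ∫⁻ x, w x ∂μ - (Δ (-h) + Δ h))
    ?_ tendsto_const_nhds (fun h => tsub_le_iff_right.2 (hlower h)) hupper
  simpa using ENNReal.Tendsto.sub tendsto_const_nhds (hΔ_neg.add hΔ) (Or.inl hfinite)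

end Translation

section SymmOverlap

variable {γ : Measure ℝ} {w : ℝ → ℝ≥0∞}

theorem lintegral_even_mul_sq_le [γ.IsNegInvariant] (hw : Measurable w)
    (heven : ∀ n, w (-n) = w n) (c : ℝ) :
    ∫⁻ n, w n * ENNReal.ofReal (n ^ 2) ∂γ ≤ ∫⁻ n, w n * ENNReal.ofReal ((c - n) ^ 2) ∂γ := by
  have hflip : ∫⁻ n, w n * ENNReal.ofReal ((c + n) ^ 2) ∂γ =
      ∫⁻ n, w n * ENNReal.ofReal ((c - n) ^ 2) ∂γ := by
    rw [← lintegral_neg_eq_self]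
    simp only [heven, sub_eq_add_neg]
  have hpointwise (n : ℝ) : w n * ENNReal.ofReal (n ^ 2) + w n * ENNReal.ofReal (n ^ 2) ≤
      w n * ENNReal.ofReal ((c - n) ^ 2) + w n * ENNReal.ofReal ((c + n) ^ 2) := by
    simp only [← mul_add, ← ENNReal.ofReal_add (sq_nonneg _) (sq_nonneg _)]
    refine mul_le_mul_right (ENNReal.ofReal_le_ofReal ?_) _
    linarith [sq_nonneg c, sub_sq c n, add_sq c n]
  have hdouble := lintegral_mono (μ := γ) hpointwise
  rw [lintegral_add_left (by fun_prop), lintegral_add_left (by fun_prop), hflip, ← two_mul,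
    ← two_mul] at hdouble
  exact (ENNReal.mul_le_mul_iff_right two_ne_zero ENNReal.ofNat_ne_top).1 hdouble

/-- The second moment of the largest part of the noise `γ` that is symmetric given the observation
`r z + n`, where `z` has density `w`: seen from `x = z + n / r`, the noises `n` and `-n` have
weights `w (x - n / r)` and `w (x + n / r)`, of which the minimum is kept. It is a lower bound for
the scaled mean square error of every estimator of `z`. -/
noncomputable def symmOverlap (w : ℝ → ℝ≥0∞) (γ : Measure ℝ) (r : ℝ) : ℝ≥0∞ :=
  ∫⁻ n, (∫⁻ x, min (w (x - n / r)) (w (x + n / r))) * ENNReal.ofReal (n ^ 2) ∂γ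

theorem symmOverlap_le_lintegral_sq [SFinite γ] [γ.IsNegInvariant] (hw : Measurable w) {r : ℝ}
    (hr : r ≠ 0) {c : ℝ → ℝ} (hc : Measurable c) :
    symmOverlap w γ r ≤
      ∫⁻ n, ∫⁻ z, w z * ENNReal.ofReal ((r * (z - c (r * z + n))) ^ 2) ∂volume ∂γ := by
  let overlap (x n : ℝ) : ℝ≥0∞ := min (w (x - n / r)) (w (x + n / r))
  let k (x : ℝ) : ℝ := r * (x - c (r * x))
  calc symmOverlap w γ r
    _ = ∫⁻ n, ∫⁻ x, overlap x n * ENNReal.ofReal (n ^ 2) ∂volume ∂γ :=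
      lintegral_congr fun n => (lintegral_mul_const _ (by fun_prop)).symm
    _ = ∫⁻ x, ∫⁻ n, overlap x n * ENNReal.ofReal (n ^ 2) ∂γ ∂volume :=
      lintegral_lintegral_swap (by fun_prop)
    _ ≤ ∫⁻ x, ∫⁻ n, overlap x n * ENNReal.ofReal ((k x - n) ^ 2) ∂γ ∂volume :=
      lintegral_mono fun x => lintegral_even_mul_sq_le (by fun_prop) (fun n => by
        simp only [overlap, neg_div, sub_neg_eq_add, ← sub_eq_add_neg, min_comm]) (k x)
    _ = ∫⁻ n, ∫⁻ x, overlap x n * ENNReal.ofReal ((k x - n) ^ 2) ∂volume ∂γ :=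
      lintegral_lintegral_swap (by fun_prop)
    _ ≤ ∫⁻ n, ∫⁻ x, w (x - n / r) * ENNReal.ofReal ((k x - n) ^ 2) ∂volume ∂γ := by
      gcongr
      exact min_le_left _ _
    _ = ∫⁻ n, ∫⁻ z, w z * ENNReal.ofReal ((r * (z - c (r * z + n))) ^ 2) ∂volume ∂γ :=
      lintegral_congr fun n => by
        rw [← lintegral_sub_right_eq_self
          (fun z => w z * ENNReal.ofReal ((r * (z - c (r * z + n))) ^ 2)) (n / r)]
        refine lintegral_congr fun x => ?_
        have hobservation : r * (x - n / r) + n = r * x := by field_simp; ring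
        rw [hobservation]
        congr 3
        simp only [k]
        field_simp
        ring

theorem tendsto_symmOverlap (hw : Measurable w) (hfinite : ∫⁻ x, w x ≠ ∞)
    (hγ : ∫⁻ n, ENNReal.ofReal (n ^ 2) ∂γ ≠ ∞) :
    Tendsto (symmOverlap w γ) atTop
      (𝓝 ((∫⁻ x, w x) * ∫⁻ n, ENNReal.ofReal (n ^ 2) ∂γ)) := by
  rw [← lintegral_const_mul _ (by fun_prop)]
  refine tendsto_lintegral_filter_of_dominated_convergence
    (fun n => (∫⁻ x, w x) * ENNReal.ofReal (n ^ 2)) (Eventually.of_forall fun r => ?_)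
    (Eventually.of_forall fun r => Eventually.of_forall fun n => ?_) ?_
    (Eventually.of_forall fun n => ?_)
  · exact (Measurable.lintegral_prod_right' (f := fun p : ℝ × ℝ =>
      min (w (p.2 - p.1 / r)) (w (p.2 + p.1 / r))) (by fun_prop)).mul (by fun_prop)
  · exact mul_le_mul_left ((lintegral_mono fun x => min_le_left _ _).trans_eq
      (lintegral_sub_right_eq_self w _)) _
  · rw [lintegral_const_mul _ (by fun_prop)]
    exact ENNReal.mul_ne_top hfinite hγ
  · exact ENNReal.Tendsto.mul_const
      ((tendsto_lintegral_min_translate hw hfinite).comp (tendsto_id.const_div_atTop n))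
      (Or.inr ENNReal.ofReal_ne_top)

end SymmOverlap

section LowerBound

variable {Ω β : Type*} [MeasurableSpace Ω] {P : Measure Ω} {Z : Ω → ℝ} {U : Ω → β}

/-- The density of `Z` on the event `U = u`, of total mass `ℙ(U = u)`. -/
noncomputable def sliceDensity (P : Measure Ω) (Z : Ω → ℝ) (U : Ω → β) (u : β) : ℝ → ℝ≥0∞ :=
  ((P.restrict (U ⁻¹' {u})).map Z).rnDeriv volume

theorem lintegral_sliceDensity_mul [IsFiniteMeasure P] (hZ : Measurable Z)
    (hZac : P.map Z ≪ volume) (u : β) {F : ℝ → ℝ≥0∞} (hF : Measurable F) :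
    ∫⁻ z, sliceDensity P Z U u z * F z = ∫⁻ ω in U ⁻¹' {u}, F (Z ω) ∂P := by
  have hac : (P.restrict (U ⁻¹' {u})).map Z ≪ volume :=
    (Measure.absolutelyContinuous_of_le Measure.restrict_le_self |>.map hZ).trans hZac
  rw [← lintegral_map hF hZ]
  exact lintegral_rnDeriv_mul hac hF.aemeasurable

theorem lintegral_sliceDensity [IsFiniteMeasure P] (hZ : Measurable Z)
    (hZac : P.map Z ≪ volume) (u : β) : ∫⁻ z, sliceDensity P Z U u z = P (U ⁻¹' {u}) := by
  simpa using lintegral_sliceDensity_mul (U := U) hZ hZac u measurable_one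

variable [MeasurableSpace β] [MeasurableSingletonClass β]

theorem symmOverlap_sliceDensity_le [IsFiniteMeasure P] (hZ : Measurable Z) (hU : Measurable U)
    (hZac : P.map Z ≪ volume) {g : ℝ × β → ℝ} (hg : Measurable g) {s : ℝ} (hs : 0 < s) (u : β) :
    symmOverlap (sliceDensity P Z U u) (gaussianReal 0 1) √s ≤
      ∫⁻ ω in U ⁻¹' {u}, ∫⁻ n, ENNReal.ofReal (s * (Z ω - g (√s * Z ω + n, U ω)) ^ 2)
        ∂(gaussianReal 0 1) ∂P := by
  have hw : Measurable (sliceDensity P Z U u) := Measure.measurable_rnDeriv _ _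
  let error (z n : ℝ) : ℝ≥0∞ := ENNReal.ofReal ((√s * (z - g (√s * z + n, u))) ^ 2)
  calc symmOverlap (sliceDensity P Z U u) (gaussianReal 0 1) √s
    _ ≤ ∫⁻ n, ∫⁻ z, sliceDensity P Z U u z * error z n ∂volume ∂(gaussianReal 0 1) :=
      symmOverlap_le_lintegral_sq (c := fun x => g (x, u)) hw (Real.sqrt_pos.2 hs).ne' (by fun_prop)
    _ = ∫⁻ z, ∫⁻ n, sliceDensity P Z U u z * error z n ∂(gaussianReal 0 1) ∂volume :=
      lintegral_lintegral_swap (by fun_prop)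
    _ = ∫⁻ z, sliceDensity P Z U u z * ∫⁻ n, error z n ∂(gaussianReal 0 1) ∂volume :=
      lintegral_congr fun z => lintegral_const_mul _ (by fun_prop)
    _ = ∫⁻ ω in U ⁻¹' {u}, ∫⁻ n, error (Z ω) n ∂(gaussianReal 0 1) ∂P :=
      lintegral_sliceDensity_mul hZ hZac u
        (Measurable.lintegral_prod_right' (f := fun p : ℝ × ℝ => error p.1 p.2) (by fun_prop))
    _ = ∫⁻ ω in U ⁻¹' {u}, ∫⁻ n, ENNReal.ofReal (s * (Z ω - g (√s * Z ω + n, U ω)) ^ 2)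
        ∂(gaussianReal 0 1) ∂P := by
      refine setLIntegral_congr_fun (hU (measurableSet_singleton u)) fun ω hω => ?_
      simp only [error, mul_pow, Real.sq_sqrt hs.le, show U ω = u from hω]

theorem sum_symmOverlap_sliceDensity_le [IsFiniteMeasure P] (hZ : Measurable Z)
    (hU : Measurable U) (hZac : P.map Z ≪ volume) {g : ℝ × β → ℝ} (hg : Measurable g) {s : ℝ}
    (hs : 0 < s) (t : Finset β) :
    ∑ u ∈ t, symmOverlap (sliceDensity P Z U u) (gaussianReal 0 1) √s ≤
      ENNReal.ofReal s * meanSqError P Z U s g := by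
  let error (ω : Ω) : ℝ≥0∞ :=
    ∫⁻ n, ENNReal.ofReal (s * (Z ω - g (√s * Z ω + n, U ω)) ^ 2) ∂(gaussianReal 0 1)
  calc ∑ u ∈ t, symmOverlap (sliceDensity P Z U u) (gaussianReal 0 1) √s
    _ ≤ ∑ u ∈ t, ∫⁻ ω in U ⁻¹' {u}, error ω ∂P :=
      Finset.sum_le_sum fun u _ => symmOverlap_sliceDensity_le hZ hU hZac hg hs u
    _ = ∫⁻ ω in ⋃ u ∈ t, U ⁻¹' {u}, error ω ∂P :=
      (lintegral_biUnion_finset (fun u _ v _ huv => Disjoint.preimage U (by simpa using huv))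
        (fun u _ => hU (measurableSet_singleton u)) _).symm
    _ ≤ ∫⁻ ω, error ω ∂P := setLIntegral_le_lintegral _ _
    _ = ENNReal.ofReal s * meanSqError P Z U s g := by
      rw [meanSqError, ← lintegral_const_mul _ (by fun_prop), lintegral_prod _ (by fun_prop)]
      simp only [error, ENNReal.ofReal_mul hs.le]

theorem tendsto_sum_symmOverlap_sliceDensity [IsFiniteMeasure P] (hZ : Measurable Z)
    (hU : Measurable U) (hZac : P.map Z ≪ volume) (t : Finset β) :
    Tendsto (fun r => ∑ u ∈ t, symmOverlap (sliceDensity P Z U u) (gaussianReal 0 1) r) atTop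
      (𝓝 (P (U ⁻¹' t))) := by
  have hslice (u : β) := tendsto_symmOverlap (γ := gaussianReal 0 1)
    (w := sliceDensity P Z U u) (Measure.measurable_rnDeriv _ _)
    (by rw [lintegral_sliceDensity hZ hZac]; exact measure_ne_top P _)
    (by rw [lintegral_sq_gaussianReal]; exact ENNReal.one_ne_top)
  simp only [lintegral_sliceDensity hZ hZac, lintegral_sq_gaussianReal, mul_one] at hslice
  rw [← sum_measure_preimage_singleton t fun u _ => hU (measurableSet_singleton u)]
  exact tendsto_finsetSum t fun u _ => hslice u

theorem eventually_lt_mul_condMMSE [IsProbabilityMeasure P] (hZ : Measurable Z)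
    (hU : Measurable U) (hZac : P.map Z ≪ volume) (hZ2 : MemLp Z 2 P) {Q : Set β}
    (hQ : Q.Countable) {a : ℝ} (ha : a < P.real (U ⁻¹' Q)) :
    ∀ᶠ s : ℝ in atTop, a < s * condMMSE P Z U s := by
  rcases lt_or_ge a 0 with hneg | hnonneg
  · exact (eventually_ge_atTop 0).mono fun s hs =>
      hneg.trans_le (mul_nonneg hs (integral_nonneg fun _ => sq_nonneg _))
  rw [← map_measureReal_apply hU hQ.measurableSet] at ha
  obtain ⟨t, -, hat⟩ := exists_finset_subset_lt_measureReal hQ ha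
  rw [map_measureReal_apply hU t.measurableSet] at hat
  have hlim := (tendsto_sum_symmOverlap_sliceDensity hZ hU hZac t).comp Real.tendsto_sqrt_atTop
  have hat' : ENNReal.ofReal a < P (U ⁻¹' t) :=
    (ENNReal.ofReal_lt_iff_lt_toReal hnonneg (measure_ne_top P _)).2 hat
  filter_upwards [hlim.eventually_const_lt hat', eventually_gt_atTop 0] with s hlt hs
  obtain ⟨g, hg, hgmmse⟩ := exists_meanSqError_eq_ofReal_condMMSE (U := U) hZ2 s
  have hle := sum_symmOverlap_sliceDensity_le hZ hU hZac hg hs t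
  rw [hgmmse, ← ENNReal.ofReal_mul hs.le] at hle
  exact lt_of_not_ge fun h => ((hlt.trans_le hle).trans_le (ENNReal.ofReal_le_ofReal h)).false

theorem hasCondMMSEDimension_of_estimator [IsProbabilityMeasure P] (hZ : Measurable Z)
    (hU : Measurable U) (hZac : P.map Z ≪ volume) (hZ2 : MemLp Z 2 P) {Q : Set β}
    (hQ : Q.Countable) {g : ℝ × β → ℝ} (hg : Measurable g) {C : ℝ}
    (hbound : ∀ᵐ ω ∂P, U ω ∉ Q → ∀ x, |Z ω - g (x, U ω)| ≤ C * |x - Z ω|)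
    (hlocal : ∀ᵐ ω ∂P, U ω ∉ Q → ∀ᶠ x in 𝓝 (Z ω), g (x, U ω) = Z ω) :
    HasCondMMSEDimension P Z U (P.real (U ⁻¹' Q)) :=
  tendsto_order.2 ⟨fun _ ha => eventually_lt_mul_condMMSE hZ hU hZac hZ2 hQ ha,
    fun _ hb => eventually_mul_condMMSE_lt hZ hU hZ2 hQ.measurableSet hg hbound hlocal hb⟩

end LowerBound

section Estimator

theorem exists_measurable_leftInvOn {E β : Type*} [MeasurableSpace E] [StandardBorelSpace E]
    [Nonempty E] [MeasurableSpace β] [MeasurableSpace.CountablySeparated β] {f : E → β}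
    (hf : Measurable f) {s : Set E} (hs : MeasurableSet s) (hinj : Set.InjOn f s) :
    ∃ e : β → E, Measurable e ∧ Set.LeftInvOn e f s := by
  have := hs.standardBorel
  have hemb : MeasurableEmbedding (s.domRestrict f) :=
    (hf.comp measurable_subtype_coe).measurableEmbedding (Set.injOn_iff_injective.1 hinj)
  obtain ⟨e, he, hef⟩ := hemb.exists_measurable_extend measurable_subtype_coe fun _ => ‹_›
  exact ⟨e, he, fun z hz => congrFun hef ⟨z, hz⟩⟩

theorem exists_measurable_nearest {E β ι : Type*} [PseudoMetricSpace E]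
    [SecondCountableTopology E] [MeasurableSpace E] [OpensMeasurableSpace E] [MeasurableSpace β]
    {h : ι → β → E} (hh : ∀ k, Measurable (h k)) {s : Finset ι} (hs : s.Nonempty) :
    ∃ g : E × β → E, Measurable g ∧ ∀ x y,
      (∃ k ∈ s, g (x, y) = h k y) ∧ ∀ k ∈ s, dist x (g (x, y)) ≤ dist x (h k y) := by
  classical
  induction hs using Finset.Nonempty.cons_induction with
  | singleton k => exact ⟨fun p => h k p.2, by fun_prop, by simp⟩
  | cons k s _ _ ih =>
    obtain ⟨g, hg, hnear⟩ := ih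
    refine ⟨fun p => if dist p.1 (g p) ≤ dist p.1 (h k p.2) then g p else h k p.2,
      Measurable.ite (measurableSet_le (by fun_prop) (by fun_prop)) hg (by fun_prop),
      fun x y => ?_⟩
    obtain ⟨⟨j, hj, hgj⟩, hle⟩ := hnear x y
    simp only [Finset.mem_cons, exists_eq_or_imp, forall_eq_or_imp]
    split_ifs with hcmp
    · exact ⟨Or.inr ⟨j, hj, hgj⟩, hcmp, hle⟩
    · exact ⟨Or.inl rfl, le_rfl, fun i hi => (not_le.1 hcmp).le.trans (hle i hi)⟩

theorem eventually_eq_of_dist_le_of_mem_finite {E : Type*} [MetricSpace E] {g : E → E} {z : E}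
    {C : ℝ} {F : Set E} (hF : F.Finite) (hgF : ∀ x, g x ∈ F)
    (hdist : ∀ x, dist z (g x) ≤ C * dist x z) : ∀ᶠ x in 𝓝 z, g x = z := by
  have hlim : Tendsto g (𝓝 z) (𝓝 z) := by
    have hsmall : Tendsto (fun x => C * dist x z) (𝓝 z) (𝓝 0) := by
      simpa using ((tendsto_iff_dist_tendsto_zero.1 (tendsto_id (x := 𝓝 z))).const_mul C)
    exact tendsto_iff_dist_tendsto_zero.2 (squeeze_zero (fun _ => dist_nonneg)
      (fun x => (dist_comm _ _).trans_le (hdist x)) hsmall)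
  have hopen : (F \ {z})ᶜ ∈ 𝓝 z :=
    (hF.subset Set.sdiff_subset).isClosed.isOpen_compl.mem_nhds fun hz => hz.2 rfl
  filter_upwards [hlim hopen] with x hx
  by_contra hne
  exact hx ⟨hgF x, hne⟩

theorem exists_measurable_estimator {E β : Type*} [MetricSpace E] [SecondCountableTopology E]
    [MeasurableSpace E] [BorelSpace E] [StandardBorelSpace E] [Nonempty E] [MeasurableSpace β]
    [MeasurableSpace.CountablySeparated β] {f : E → β} (hf : Measurable f) {𝒮 : Set (Set E)}
    (hfin : 𝒮.Finite) (hinj : ∀ s ∈ 𝒮, MeasurableSet s ∧ Set.InjOn f s) :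
    ∃ g : E × β → E, Measurable g ∧ ∀ z ∈ ⋃₀ 𝒮,
      (∀ x, dist z (g (x, f z)) ≤ 2 * dist x z) ∧ ∀ᶠ x in 𝓝 z, g (x, f z) = z := by
  rcases 𝒮.eq_empty_or_nonempty with rfl | hne
  · exact ⟨Prod.fst, measurable_fst, by simp⟩
  have : Fintype 𝒮 := hfin.fintype
  have : Nonempty 𝒮 := hne.to_subtype
  choose e he hleft using fun s : 𝒮 =>
    exists_measurable_leftInvOn hf (hinj s s.2).1 (hinj s s.2).2
  obtain ⟨g, hg, hnear⟩ := exists_measurable_nearest he (Finset.univ_nonempty (α := 𝒮))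
  refine ⟨g, hg, ?_⟩
  rintro z ⟨s, hs, hzs⟩
  have hdist (x : E) : dist z (g (x, f z)) ≤ 2 * dist x z := by
    have hcand : dist x (g (x, f z)) ≤ dist x z := by
      simpa only [hleft ⟨s, hs⟩ hzs] using (hnear x (f z)).2 ⟨s, hs⟩ (Finset.mem_univ _)
    linarith [dist_triangle_left z (g (x, f z)) x]
  refine ⟨hdist, eventually_eq_of_dist_le_of_mem_finite
    (Set.finite_range fun t => e t (f z)) (fun x => ?_) hdist⟩
  obtain ⟨t, -, ht⟩ := (hnear x (f z)).1
  exact ⟨t, ht.symm⟩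

end Estimator

section PiecewiseSmooth

variable {Ω : Type*} [MeasurableSpace Ω] {P : Measure Ω} {Z : Ω → ℝ} {f : ℝ → ℝ}

theorem IsPiecewiseInjOffFlat.measureReal_flatValues_eq (hf : IsPiecewiseInjOffFlat f)
    (hZ : Measurable Z) (hZac : P.map Z ≪ volume) :
    P.real {ω | f (Z ω) ∈ flatValues f} = P.real {ω | Z ω ∈ flatSections f} := by
  refine measureReal_congr ?_
  filter_upwards [ae_of_ae_map hZ.aemeasurable (hZac.ae_le hf.ae_mem_flatSections)] with ω hω
  exact propext ⟨hω, map_mem_flatValues_of_mem_flatSections⟩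

variable [IsProbabilityMeasure P]

theorem IsPiecewiseInjOffFlat.hasCondMMSEDimension (hf : IsPiecewiseInjOffFlat f)
    (hmeas : Measurable f) (hZ : Measurable Z) (hZac : P.map Z ≪ volume) (hZ2 : MemLp Z 2 P) :
    HasCondMMSEDimension P Z (fun ω => f (Z ω)) (P.real {ω | f (Z ω) ∈ flatValues f}) := by
  obtain ⟨𝒮, hfin, hinj, hcover⟩ := hf
  obtain ⟨g, hg, hest⟩ := exists_measurable_estimator hmeas hfin hinj
  have hmem (ω : Ω) (hω : f (Z ω) ∉ flatValues f) : Z ω ∈ ⋃₀ 𝒮 :=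
    hcover fun hsec => hω (map_mem_flatValues_of_mem_flatSections hsec)
  exact hasCondMMSEDimension_of_estimator hZ (hmeas.comp hZ) hZac hZ2 (countable_flatValues f) hg
    (ae_of_all P fun ω hω x => (hest _ (hmem ω hω)).1 x)
    (ae_of_all P fun ω hω => (hest _ (hmem ω hω)).2)

theorem IsPiecewiseInjOffFlat.hasInformationDimension (hf : IsPiecewiseInjOffFlat f)
    (hmeas : Measurable f) (hcrit : ∀ᵐ z, z ∉ flatSections f → deriv f z ≠ 0)
    (hZ : Measurable Z) (hZac : P.map Z ≪ volume)
    (hH : discreteEntropy P (fun ω => ⌊f (Z ω)⌋) ≠ ∞) :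
    HasInformationDimension P (fun ω => f (Z ω)) (1 - P.real {ω | f (Z ω) ∈ flatValues f}) := by
  refine hasInformationDimension_of_restrict_absolutelyContinuous (hmeas.comp hZ)
    (countable_flatValues f) ?_ hH
  rw [← Measure.map_map hmeas hZ]
  exact hf.restrict_map_absolutelyContinuous hmeas hcrit hZac

end PiecewiseSmooth

theorem mainTheorem9_general {Ω : Type*} [MeasurableSpace Ω] (P : Measure Ω)
    [IsProbabilityMeasure P] (Z : Ω → ℝ) (hZ : Measurable Z) (hZac : P.map Z ≪ volume)
    (hZ2 : MemLp Z 2 P) (f : ℝ → ℝ) (hmeas : Measurable f) (hf : IsPiecewiseInjOffFlat f)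
    (hcrit : ∀ᵐ z : ℝ ∂volume, z ∉ flatSections f → deriv f z ≠ 0)
    (hH : discreteEntropy P (fun ω => ⌊f (Z ω)⌋) ≠ ∞) :
    ∃ D : ℝ,
      HasCondMMSEDimension P Z (fun ω => f (Z ω)) D ∧
      HasInformationDimension P (fun ω => f (Z ω)) (1 - D) ∧
      D = P.real {ω | f (Z ω) ∈ flatValues f} ∧
      D = P.real {ω | Z ω ∈ flatSections f} :=
  ⟨P.real {ω | f (Z ω) ∈ flatValues f}, hf.hasCondMMSEDimension hmeas hZ hZac hZ2,
    hf.hasInformationDimension hmeas hcrit hZ hZac hH, rfl, hf.measureReal_flatValues_eq hZ hZac⟩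

theorem mainTheorem9 {Ω : Type*} [MeasurableSpace Ω] (P : Measure Ω) [IsProbabilityMeasure P]
    (Z : Ω → ℝ) (hZ : Measurable Z) (hZlaw : P.map Z = gaussianReal 0 1)
    (f : ℝ → ℝ) (hf : IsPiecewiseSmooth f)
    (hcrit : ∀ᵐ z : ℝ ∂volume, z ∉ flatSections f → deriv f z ≠ 0)
    (hH : discreteEntropy P (fun ω => ⌊f (Z ω)⌋) ≠ ∞) :
    ∃ D : ℝ,
      HasCondMMSEDimension P Z (fun ω => f (Z ω)) D ∧
      HasInformationDimension P (fun ω => f (Z ω)) (1 - D) ∧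
      D = P.real {ω | f (Z ω) ∈ flatValues f} ∧
      D = P.real {ω | Z ω ∈ flatSections f} :=
  mainTheorem9_general P Z hZ (hZlaw ▸ gaussianReal_absolutelyContinuous 0 one_ne_zero)
    (HasLaw.mk hZ.aemeasurable hZlaw).hasGaussianLaw.memLp_two f hf.measurable
    hf.isPiecewiseInjOffFlat hcrit hH
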